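/- Let $n\ge 1$ and let $K\subset\mathbb R^n$ be a convex body (a compact convex set with non-empty interior) of volume $1$ that is centered, i.e. whose barycenter $\frac1{|K|}\int_K x\,dx$ is the origin. Let $\kappa\in(0,1/n]$ and let $\mu$ be a Borel probability measure on $\mathbb R^n$ with topological support $\operatorname{supp}(\mu)=K$ which is centered, i.e. $\int_{\mathbb R^n}\langle x,\xi\rangle\,d\mu(x)=0$ for every unit vector $\xi$, and $\kappa$-concave, i.e. $$\mu((1-\lambda)A+\lambda B)\ \ge\ \big((1-\lambda)\mu(A)^{\kappa}+\lambda\mu(B)^{\kappa}\big)^{1/\kappa}$$ for all compact sets $A,B\subset\mathbb R^n$ with $\mu(A)\mu(B)>0$ and all $\lambda\in(0,1)$. Let $$\Lambda_\mu(\xi)=\ln\int_{\mathbb R^n}e^{\langle\xi,z\rangle}\,d\mu(z),\qquad \Lambda^*_\mu(x)=\sup_{\xi\in\mathbb R^n}\{\langle x,\xi\rangle-\Lambda_\mu(\xi)\}\in[0,\infty]$$ be the logarithmic Laplace transform and the Cramer transform of $\mu$. Then $$\int_{\mathbb R^n}e^{\kappa\Lambda^*_\mu(x)/2}\,d\mu(x)<\infty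 ,$$ and for every real $p\ge 1$ $$\int_{\mathbb R^n}\big(\Lambda^*_\mu(x)\big)^p\,d\mu(x)<\infty .$$ -/

import Mathlib

open MeasureTheory
open scoped ENNReal Pointwise RealInnerProductSpace

noncomputable section

/-- The logarithmic Laplace transform `Λ_μ(ξ) = ln ∫ e^⟨ξ,z⟩ dμ(z)` of a measure on `ℝⁿ`,
with values in the extended reals (the integral may be infinite). -/
def logLaplace {n : ℕ} (μ : Measure (EuclideanSpace ℝ (Fin n)))
    (ξ : EuclideanSpace ℝ (Fin n)) : EReal :=
  ENNReal.log (∫⁻ z, ENNReal.ofReal (Real.exp ⟪ξ, z⟫) ∂μ)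

/-- The Cramer transform `Λ*_μ(x) = sup_ξ (⟨x,ξ⟩ - Λ_μ(ξ))`, the Legendre transform of `Λ_μ`,
with values in the extended reals. -/
def cramerTransform {n : ℕ} (μ : Measure (EuclideanSpace ℝ (Fin n)))
    (x : EuclideanSpace ℝ (Fin n)) : EReal :=
  ⨆ ξ : EuclideanSpace ℝ (Fin n), ((⟪x, ξ⟫ : ℝ) : EReal) - logLaplace μ ξ

/-- The Cramer transform of a probability measure is nonnegative, so that
`(cramerTransform μ x).toENNReal` is the same extended number. -/
theorem cramerTransform_nonneg {n : ℕ} (μ : Measure (EuclideanSpace ℝ (Fin n)))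
    [IsProbabilityMeasure μ] (x : EuclideanSpace ℝ (Fin n)) : 0 ≤ cramerTransform μ x := by
  refine le_trans ?_ (le_iSup _ (0 : EuclideanSpace ℝ (Fin n)))
  simp [logLaplace]

/-- A measure `μ` on `ℝⁿ` is centered if its barycenter exists and is the origin:
`∫ ⟨x,ξ⟩ dμ(x) = 0` for all `ξ` in the unit sphere. -/
def IsCenteredMeasure {n : ℕ} (μ : Measure (EuclideanSpace ℝ (Fin n))) : Prop :=
  Integrable (fun x => x) μ ∧
    ∀ ξ : EuclideanSpace ℝ (Fin n), ‖ξ‖ = 1 → ∫ x, ⟪x, ξ⟫ ∂μ = 0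

/-- A set `K` in `ℝⁿ` is centered if its barycenter `|K|⁻¹ ∫_K x dx` is the origin.
This is used for compact sets of positive volume. -/
def IsCenteredSet {n : ℕ} (K : Set (EuclideanSpace ℝ (Fin n))) : Prop :=
  ⨍ x in K, x = 0

/-- A measure on `ℝⁿ` is `κ`-concave, where `0 < κ`, if
`μ((1-t)A + tB) ≥ ((1-t) μ(A)^κ + t μ(B)^κ)^(1/κ)` for all compact sets `A`, `B` with
`μ(A) μ(B) > 0` and all `t ∈ (0,1)`. The sum of sets is the Minkowski sum. -/
def IsKappaConcave {n : ℕ} (κ : ℝ) (μ : Measure (EuclideanSpace ℝ (Fin n))) : Prop :=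
  ∀ A B : Set (EuclideanSpace ℝ (Fin n)), IsCompact A → IsCompact B → 0 < μ A * μ B →
    ∀ t : ℝ, 0 < t → t < 1 →
      (ENNReal.ofReal (1 - t) * μ A ^ κ + ENNReal.ofReal t * μ B ^ κ) ^ (1 / κ)
        ≤ μ ((1 - t) • A + t • B)

end

open Filter Topology Metric

section KappaConcave

variable {n : ℕ} {κ : ℝ} {μ : Measure (EuclideanSpace ℝ (Fin n))}

/-! Fix `x₀` interior to the support `K` and write `x = t x₀ + (1 - t) y` with `y ∈ K`. A half-space
with `x` on its boundary contains the copy, shrunk by `t` towards `y`, of a compact set in the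
parallel half-space through `x₀`. By concavity its mass is at least `c t^(1/κ)`, with `c > 0`
independent of `x` and of the direction. Chernoff's bound then gives `exp(κ Λ*(x) / 2) ≤ C
t^(-1/2)`. Such points with `t` fixed fill all but mass `t / κ` of the measure, so the singularity
`t^(-1/2)` is integrable. Powers of `Λ*` are dominated by the exponential. -/

/-- A `κ`-concave measure shrinks by at most `t ^ (1 / κ)` under a homothety of ratio `t` centered
at a point of its support. -/
theorem IsKappaConcave.rpow_mul_le_measure_homothety [IsFiniteMeasure μ]
    (hμ : IsKappaConcave κ μ) (hκ : 0 < κ) {y : EuclideanSpace ℝ (Fin n)} (hy : y ∈ μ.support)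
    {B : Set (EuclideanSpace ℝ (Fin n))} (hB : IsCompact B) {t : ℝ} (ht0 : 0 < t) (ht1 : t < 1) :
    ENNReal.ofReal t ^ (1 / κ) * μ B ≤ μ ((fun b => (1 - t) • y + t • b) '' B) := by
  rcases eq_or_ne (μ B) 0 with h0 | h0
  · simp [h0]
  have hC : IsCompact ((fun b => (1 - t) • y + t • b) '' B) := hB.image (by fun_prop)
  -- The point `y` may be null, so concavity is applied to a small ball around it; the Minkowski
  -- combination stays in the `δ`-thickening of the image, and `δ → 0`.
  have hlim := (tendsto_measure_cthickening_of_isCompact (μ := μ) hC).mono_left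
    (nhdsWithin_le_nhds (s := Set.Ioi (0 : ℝ)))
  refine ge_of_tendsto hlim (eventually_mem_nhdsWithin.mono fun δ (hδ : 0 < δ) => ?_)
  have hball : 0 < μ (closedBall y δ) :=
    (Measure.mem_support_iff_forall y).1 hy _ (closedBall_mem_nhds y hδ)
  have hconc := hμ (closedBall y δ) B (isCompact_closedBall y δ) hB
    (ENNReal.mul_pos hball.ne' h0) t ht0 ht1
  have hpow : ENNReal.ofReal t ^ (1 / κ) * μ B = (ENNReal.ofReal t * μ B ^ κ) ^ (1 / κ) := by
    rw [ENNReal.mul_rpow_of_nonneg _ _ (by positivity), ← ENNReal.rpow_mul,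
      mul_one_div_cancel hκ.ne', ENNReal.rpow_one]
  rw [hpow]
  refine (ENNReal.rpow_le_rpow le_add_self (by positivity)).trans (hconc.trans (measure_mono ?_))
  rintro _ ⟨_, ⟨a, ha, rfl⟩, _, ⟨b, hb, rfl⟩, rfl⟩
  refine mem_cthickening_of_dist_le _ _ _ _ (Set.mem_image_of_mem _ hb) ?_
  have ha' : dist a y ≤ δ := ha
  simp only [dist_add_right, dist_smul₀, Real.norm_eq_abs, abs_of_pos (sub_pos.2 ht1)]
  nlinarith [dist_nonneg (x := a) (y := y)]

/-- Half-spaces whose boundary passes through a fixed interior point of the support contain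
compact sets of measure bounded below. -/
theorem exists_forall_isCompact_subset_halfSpace {x₀ : EuclideanSpace ℝ (Fin n)}
    (hx₀ : x₀ ∈ interior μ.support) :
    ∃ c : ℝ≥0∞, c ≠ 0 ∧ ∀ ξ : EuclideanSpace ℝ (Fin n), ∃ B : Set (EuclideanSpace ℝ (Fin n)),
      IsCompact B ∧ c ≤ μ B ∧ ∀ z ∈ B, ⟪x₀, ξ⟫ ≤ ⟪z, ξ⟫ := by
  -- In the ball of radius `ρ` about `x₀ + ρ σ`, each `z i - x₀ i` is zero or has the sign `σ i`
  -- when `σ i ≠ 0`. Taking `σ` to be the signs of `ξ` makes `⟪z - x₀, ξ⟫` a sum of nonnegative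
  -- terms, and only finitely many balls occur.
  let v : (Fin n → SignType) → EuclideanSpace ℝ (Fin n) :=
    fun σ => WithLp.toLp 2 fun i => ((σ i : ℤ) : ℝ)
  have hev : ∀ᶠ ρ in 𝓝[>] (0 : ℝ), ∀ σ, x₀ + ρ • v σ ∈ μ.support := by
    rw [eventually_all]
    intro σ
    have hc : Tendsto (fun ρ : ℝ => x₀ + ρ • v σ) (𝓝[>] 0) (𝓝 x₀) := by
      have : Continuous fun ρ : ℝ => x₀ + ρ • v σ := by fun_prop
      simpa using (this.tendsto 0).mono_left nhdsWithin_le_nhds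
    exact hc (mem_interior_iff_mem_nhds.1 hx₀)
  obtain ⟨ρ, hρ, hρ0⟩ := (hev.and eventually_mem_nhdsWithin).exists
  have hρ0 : 0 < ρ := hρ0
  let B : (Fin n → SignType) → Set (EuclideanSpace ℝ (Fin n)) :=
    fun σ => closedBall (x₀ + ρ • v σ) ρ
  have hBpos : ∀ σ, 0 < μ (B σ) := fun σ =>
    (Measure.mem_support_iff_forall _).1 (hρ σ) _ (closedBall_mem_nhds _ hρ0)
  obtain ⟨σ₀, hσ₀⟩ := Finite.exists_min fun σ => μ (B σ)
  refine ⟨μ (B σ₀), (hBpos σ₀).ne', fun ξ => ⟨B fun i => SignType.sign (ξ i),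
    isCompact_closedBall _ _, hσ₀ _, fun z hz => ?_⟩⟩
  rw [← sub_nonneg, ← inner_sub_left, PiLp.inner_apply]
  refine Finset.sum_nonneg fun i _ => ?_
  have hcoord : |z i - (x₀ i + ρ * ((SignType.sign (ξ i) : ℤ) : ℝ))| ≤ ρ := by
    have h := (PiLp.norm_apply_le (z - (x₀ + ρ • v fun i => SignType.sign (ξ i))) i).trans
      (mem_closedBall_iff_norm.1 hz)
    simpa [v] using h
  have hinner : inner ℝ ((z - x₀) i) (ξ i) = (z i - x₀ i) * ξ i := by
    simp [mul_comm]
  rw [hinner]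
  rw [abs_le] at hcoord
  rcases lt_trichotomy (ξ i) 0 with h | h | h
  · simp only [sign_neg h, SignType.coe_neg_one, Int.cast_neg,
      Int.cast_one] at hcoord
    nlinarith
  · simp [h]
  · simp only [sign_pos h, SignType.coe_one, Int.cast_one] at hcoord
    nlinarith

/-- Chernoff's bound: if all half-spaces containing `x` have measure at least `m`, then the Cramer
transform at `x` is at most `-log m`. -/
theorem cramerTransform_le_log_inv [IsFiniteMeasure μ] {x : EuclideanSpace ℝ (Fin n)}
    {m : ℝ≥0∞} (hm : m ≠ 0) (h : ∀ ξ, m ≤ μ {z | ⟪x, ξ⟫ ≤ ⟪z, ξ⟫}) :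
    cramerTransform μ x ≤ ENNReal.log m⁻¹ := by
  refine iSup_le fun ξ => ?_
  have hmt : m ≠ ⊤ := ((h ξ).trans_lt (measure_lt_top _ _)).ne
  have hI : ENNReal.ofReal (Real.exp ⟪x, ξ⟫) * m
      ≤ ∫⁻ z, ENNReal.ofReal (Real.exp ⟪ξ, z⟫) ∂μ := by
    refine (mul_le_mul_right (h ξ) _).trans ?_
    have hmeas : MeasurableSet {z : EuclideanSpace ℝ (Fin n) | ⟪x, ξ⟫ ≤ ⟪z, ξ⟫} :=
      measurableSet_le measurable_const (by fun_prop)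
    rw [← lintegral_indicator_const hmeas]
    refine lintegral_mono (Set.indicator_le fun z (hz : ⟪x, ξ⟫ ≤ ⟪z, ξ⟫) => ?_)
    rw [real_inner_comm z ξ]
    exact ENNReal.ofReal_le_ofReal (Real.exp_le_exp.2 hz)
  have hlog := ENNReal.log_monotone hI
  rw [ENNReal.log_mul_add, ENNReal.log_ofReal_of_pos (Real.exp_pos _), Real.log_exp,
    ENNReal.log_pos_real hm hmt] at hlog
  rw [ENNReal.log_inv, ENNReal.log_pos_real hm hmt]
  refine (EReal.sub_le_sub le_rfl hlog).trans (le_of_eq ?_)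
  norm_cast
  ring

/-- A `κ`-concave probability measure of compact support, with `κ ≤ 1`, gives mass at most `t / κ`
to the complement of a homothetic copy of its support of ratio `1 - t`. -/
theorem IsKappaConcave.measure_compl_homothety_support_le [IsProbabilityMeasure μ]
    (hμ : IsKappaConcave κ μ) (hκ : 0 < κ) (hκ1 : κ ≤ 1) (hc : IsCompact μ.support)
    {y : EuclideanSpace ℝ (Fin n)} (hy : y ∈ μ.support) {t : ℝ} (ht0 : 0 < t) (ht1 : t < 1) :
    μ ((fun b => t • y + (1 - t) • b) '' μ.support)ᶜ ≤ ENNReal.ofReal (1 / κ * t) := by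
  have hK : μ μ.support = 1 := (prob_compl_eq_zero_iff hc.measurableSet).1
    Measure.measure_compl_support
  have h := hμ.rpow_mul_le_measure_homothety hκ hy hc (t := 1 - t) (by linarith) (by linarith)
  have hC : IsCompact ((fun b => t • y + (1 - t) • b) '' μ.support) := hc.image (by fun_prop)
  rw [hK, mul_one, sub_sub_cancel, ENNReal.ofReal_rpow_of_pos (by linarith)] at h
  rw [prob_compl_eq_one_sub hC.measurableSet, tsub_le_iff_left]
  refine le_trans ?_ (add_le_add_left h _)
  rw [← ENNReal.ofReal_add (by apply Real.rpow_nonneg; linarith) (by positivity),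
    ← ENNReal.ofReal_one]
  refine ENNReal.ofReal_le_ofReal ?_
  -- Bernoulli: `1 - t / κ ≤ (1 - t)^(1/κ)`, as `1 / κ ≥ 1`.
  have hb := one_add_mul_self_le_rpow_one_add (s := -t) (by linarith)
    (one_le_one_div hκ hκ1)
  rw [← sub_eq_add_neg] at hb
  linarith

end KappaConcave

/-- A function bounded geometrically on sets whose complements have geometrically decaying measure
has finite integral if the product of the two ratios is less than `1`. -/
theorem lintegral_lt_top_of_geometric {α : Type*} [MeasurableSpace α] {μ : Measure α}
    [IsFiniteMeasure μ] {f : α → ℝ≥0∞} {s : ℕ → Set α} (hs : ∀ k, MeasurableSet (s k))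
    {M D r q : ℝ≥0∞} (hM : M ≠ ⊤) (hD : D ≠ ⊤) (hr : r ≠ ⊤) (hrq : r * q < 1)
    (hf : ∀ k, ∀ x ∈ s k, f x ≤ M * r ^ k) (hμ : ∀ k, μ (s k)ᶜ ≤ D * q ^ k)
    (hq : q < 1) : ∫⁻ x, f x ∂μ < ⊤ := by
  have hnull : μ (⋂ k, (s k)ᶜ) = 0 := by
    have h0 : Tendsto (fun k => D * q ^ k) atTop (𝓝 0) := by
      simpa using ENNReal.Tendsto.const_mul (ENNReal.tendsto_pow_atTop_nhds_zero_of_lt_one hq)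
        (Or.inr hD)
    exact le_antisymm (ge_of_tendsto' h0 fun k =>
      (measure_mono (Set.iInter_subset _ k)).trans (hμ k)) zero_le
  have hle : ∀ᵐ x ∂μ, f x ≤ M + ∑' k, (s k)ᶜ.indicator (fun _ => M * r ^ (k + 1)) x := by
    have hae : ∀ᵐ x ∂μ, ∃ k, x ∈ s k := by
      rw [ae_iff]
      convert! hnull using 2
      ext x
      simp
    filter_upwards [hae] with x hx
    classical
    -- At the first index `k + 1` with `x ∈ s (k + 1)`, the point still lies in `(s k)ᶜ`, so the
    -- `k`-th term of the series pays for `f x`.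
    rcases hk : Nat.find hx with _ | k
    · have hx0 : x ∈ s 0 := hk ▸ Nat.find_spec hx
      exact (hf 0 x hx0).trans (by simp)
    · have hxk : x ∈ s (k + 1) := hk ▸ Nat.find_spec hx
      have hxk' : x ∈ (s k)ᶜ := Nat.find_min hx (by omega)
      refine (hf _ x hxk).trans (le_trans ?_ le_add_self)
      refine le_trans ?_ (ENNReal.le_tsum k)
      rw [Set.indicator_of_mem hxk']
  refine (lintegral_mono_ae hle).trans_lt ?_
  rw [lintegral_add_left measurable_const, lintegral_tsum fun k =>
    (measurable_const.indicator (hs k).compl).aemeasurable]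
  refine ENNReal.add_lt_top.2 ⟨by
    rw [lintegral_const]; exact ENNReal.mul_lt_top hM.lt_top (measure_lt_top _ _), ?_⟩
  have hterm : ∀ k, ∫⁻ x, (s k)ᶜ.indicator (fun _ => M * r ^ (k + 1)) x ∂μ
      ≤ M * r * D * (r * q) ^ k := fun k => by
    rw [lintegral_indicator_const (hs k).compl]
    refine (mul_le_mul_right (hμ k) _).trans (le_of_eq ?_)
    ring
  refine (ENNReal.tsum_le_tsum hterm).trans_lt ?_
  rw [ENNReal.tsum_mul_left, ENNReal.tsum_geometric]
  refine ENNReal.mul_lt_top (ENNReal.mul_lt_top (ENNReal.mul_lt_top hM.lt_top hr.lt_top)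
    hD.lt_top) (ENNReal.inv_lt_top.2 (tsub_pos_of_lt hrq))

/-- Powers are dominated by exponentials on the nonnegative extended reals. -/
theorem toENNReal_rpow_le_exp {a p : ℝ} (ha : 0 < a) (hp : 0 < p) {t : EReal} (ht : 0 ≤ t) :
    t.toENNReal ^ p ≤ ENNReal.ofReal ((p / a) ^ p) * EReal.exp ((a : EReal) * t) := by
  have hC : 0 < (p / a) ^ p := by positivity
  induction t with
  | bot => simp at ht
  | top =>
    rw [EReal.coe_mul_top_of_pos ha, EReal.exp_top, ENNReal.mul_top (by simpa using hC)]
    exact le_top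
  | coe t =>
    have ht : 0 ≤ t := by exact_mod_cast ht
    rw [← EReal.coe_mul, EReal.exp_coe, EReal.toENNReal_of_ne_top (EReal.coe_ne_top t),
      EReal.toReal_coe, ENNReal.ofReal_rpow_of_nonneg ht hp.le, ← ENNReal.ofReal_mul hC.le]
    refine ENNReal.ofReal_le_ofReal ?_
    -- This is `u ≤ exp u` at `u = a t / p`, to be raised to the power `p`.
    have h1 : t ≤ p / a * Real.exp (a * t / p) := by
      have h2 : a * t / p ≤ Real.exp (a * t / p) := by linarith [Real.add_one_le_exp (a * t / p)]
      calc t = p / a * (a * t / p) := by field_simp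
        _ ≤ _ := by gcongr
    calc t ^ p ≤ (p / a * Real.exp (a * t / p)) ^ p := by gcongr
      _ = _ := by
        rw [Real.mul_rpow (by positivity) (by positivity), ← Real.exp_mul]
        congr 2
        field_simp

/-- The exponential of a multiple of the Cramer transform of a `κ`-concave measure, on the
homothetic copies of its support centered at an interior point. -/
theorem IsKappaConcave.exists_exp_cramerTransform_le {n : ℕ} {κ : ℝ}
    {μ : Measure (EuclideanSpace ℝ (Fin n))} [IsFiniteMeasure μ] (hμ : IsKappaConcave κ μ)
    (hκ : 0 < κ) {x₀ : EuclideanSpace ℝ (Fin n)} (hx₀ : x₀ ∈ interior μ.support) :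
    ∃ M : ℝ≥0∞, M ≠ ⊤ ∧ ∀ t : ℝ, 0 < t → t < 1 →
      ∀ x ∈ (fun b => t • x₀ + (1 - t) • b) '' μ.support,
        EReal.exp (((κ / 2 : ℝ) : EReal) * cramerTransform μ x)
          ≤ M * ENNReal.ofReal ((√t)⁻¹) := by
  obtain ⟨c, hc0, hc⟩ := exists_forall_isCompact_subset_halfSpace hx₀
  refine ⟨c⁻¹ ^ (κ / 2), ENNReal.rpow_ne_top_of_nonneg (by positivity) (by simpa using hc0), ?_⟩
  rintro t ht0 ht1 _ ⟨y, hy, rfl⟩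
  have ht : ENNReal.ofReal t ≠ 0 := by simpa using ht0
  have hm : ENNReal.ofReal t ^ (1 / κ) * c ≠ 0 :=
    mul_ne_zero (ENNReal.rpow_pos (by simpa using ht0) ENNReal.ofReal_ne_top).ne' hc0
  have hC : cramerTransform μ (t • x₀ + (1 - t) • y)
      ≤ ENNReal.log (ENNReal.ofReal t ^ (1 / κ) * c)⁻¹ := by
    refine cramerTransform_le_log_inv hm fun ξ => ?_
    obtain ⟨B, hB, hcB, hBξ⟩ := hc ξ
    refine (mul_le_mul_right hcB _).trans
      ((hμ.rpow_mul_le_measure_homothety hκ hy hB ht0 ht1).trans (measure_mono ?_))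
    rintro _ ⟨b, hb, rfl⟩
    simp only [Set.mem_ofPred_eq, inner_add_left, real_inner_smul_left]
    nlinarith [hBξ b hb]
  have hmul : ((κ / 2 : ℝ) : EReal) * cramerTransform μ (t • x₀ + (1 - t) • y)
      ≤ ((κ / 2 : ℝ) : EReal) * ENNReal.log (ENNReal.ofReal t ^ (1 / κ) * c)⁻¹ :=
    mul_le_mul_of_nonneg_left hC (by exact_mod_cast (by positivity : 0 ≤ κ / 2))
  refine (EReal.exp_monotone hmul).trans (le_of_eq ?_)
  -- The factor `κ / 2` turns `t^(-1/κ)` into `t^(-1/2)`.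
  rw [← ENNReal.rpow_eq_exp_mul_log, ENNReal.mul_inv (Or.inr ?_) (Or.inr hc0),
    ENNReal.mul_rpow_of_nonneg _ _ (by positivity), mul_comm, ← ENNReal.inv_rpow,
    ← ENNReal.rpow_mul, ← ENNReal.ofReal_inv_of_pos ht0,
    ENNReal.ofReal_rpow_of_pos (by positivity), ← Real.sqrt_inv, Real.sqrt_eq_rpow]
  · congr 3
    field_simp
  · obtain ⟨B, -, hcB, -⟩ := hc 0
    exact (hcB.trans_lt (measure_lt_top _ _)).ne

theorem theorem1p2 (n : ℕ) (hn : 1 ≤ n)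
    (K : ConvexBody (EuclideanSpace ℝ (Fin n)))
    (hKint : (interior (K : Set (EuclideanSpace ℝ (Fin n)))).Nonempty)
    (hKvol : volume (K : Set (EuclideanSpace ℝ (Fin n))) = 1)
    (hKcent : IsCenteredSet (K : Set (EuclideanSpace ℝ (Fin n))))
    (κ : ℝ) (hκ0 : 0 < κ) (hκ1 : κ ≤ 1 / (n : ℝ))
    (μ : Measure (EuclideanSpace ℝ (Fin n))) (hμprob : IsProbabilityMeasure μ)
    (hμcent : IsCenteredMeasure μ) (hμconc : IsKappaConcave κ μ)
    (hμsupp : μ.support = (K : Set (EuclideanSpace ℝ (Fin n)))) :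
    (∫⁻ x, EReal.exp (((κ / 2 : ℝ) : EReal) * cramerTransform μ x) ∂μ < ∞) ∧
      ∀ p : ℝ, 1 ≤ p → ∫⁻ x, (cramerTransform μ x).toENNReal ^ p ∂μ < ∞ := by
  have hn' : (1 : ℝ) ≤ n := by exact_mod_cast hn
  have hκ1' : κ ≤ 1 := hκ1.trans (by rw [div_le_one (by linarith)]; exact hn')
  have hcpt : IsCompact μ.support := hμsupp ▸ K.isCompact
  obtain ⟨x₀, hx₀⟩ : (interior μ.support).Nonempty := hμsupp ▸ hKint
  obtain ⟨M, hM, hMle⟩ := hμconc.exists_exp_cramerTransform_le hκ0 hx₀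
  have hexp : ∫⁻ x, EReal.exp (((κ / 2 : ℝ) : EReal) * cramerTransform μ x) ∂μ < ∞ := by
    have hq0 : ∀ k : ℕ, (0 : ℝ) < (1 / 4) ^ (k + 1) := fun k => by positivity
    have hq1 : ∀ k : ℕ, (1 / 4 : ℝ) ^ (k + 1) < 1 := fun k =>
      pow_lt_one₀ (by norm_num) (by norm_num) k.succ_ne_zero
    -- With `t = 4^(-(k+1))` the bound doubles at each step while the exceptional mass is quartered,
    -- so `r * q = 1/2`. The shift `k + 1` keeps `t < 1`.
    refine lintegral_lt_top_of_geometric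
      (s := fun k => (fun b => ((1 / 4 : ℝ) ^ (k + 1)) • x₀ + (1 - (1 / 4 : ℝ) ^ (k + 1)) • b) ''
        μ.support)
      (M := M * 2) (D := ENNReal.ofReal (1 / κ * (1 / 4))) (r := 2)
      (q := ENNReal.ofReal (1 / 4)) (fun k => (hcpt.image (by fun_prop)).measurableSet)
      (ENNReal.mul_ne_top hM (by simp)) ENNReal.ofReal_ne_top (by simp) ?_ ?_ ?_ ?_
    · rw [← ENNReal.ofReal_ofNat, ← ENNReal.ofReal_mul (by norm_num), ENNReal.ofReal_lt_one]
      norm_num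
    · intro k x hx
      refine (hMle _ (hq0 k) (hq1 k) x hx).trans (le_of_eq ?_)
      have hsqrt : (√((1 / 4 : ℝ) ^ (k + 1)))⁻¹ = 2 ^ (k + 1) := by
        rw [show (1 / 4 : ℝ) ^ (k + 1) = ((2 ^ (k + 1))⁻¹) ^ 2 by
          rw [← inv_pow, ← pow_mul, mul_comm, pow_mul]; norm_num,
          Real.sqrt_sq (by positivity), inv_inv]
      rw [hsqrt, ENNReal.ofReal_pow (by norm_num), ENNReal.ofReal_ofNat, pow_succ']
      ring
    · intro k
      refine (hμconc.measure_compl_homothety_support_le hκ0 hκ1' hcpt (interior_subset hx₀)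
        (hq0 k) (hq1 k)).trans (le_of_eq ?_)
      rw [← ENNReal.ofReal_pow (by norm_num), ← ENNReal.ofReal_mul (by positivity), pow_succ']
      congr 1
      ring
    · rw [ENNReal.ofReal_lt_one]
      norm_num
  refine ⟨hexp, fun p hp => ?_⟩
  have hp0 : 0 < p := by linarith
  refine (lintegral_mono fun x => toENNReal_rpow_le_exp (half_pos hκ0) hp0
    (cramerTransform_nonneg μ x)).trans_lt ?_
  rw [lintegral_const_mul' _ _ ENNReal.ofReal_ne_top]
  exact ENNReal.mul_lt_top ENNReal.ofReal_lt_top hexp
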